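/- Let $V$ be a finite set of vertices, partitioned into $V_0$ and $V_1$, let $E\subseteq V\times V$ be a set of edges such that every vertex has at least one successor, let $E^f\subseteq E\cap(V_0\times V)$ be a set of fair edges, and let $\mathbf B\subseteq V$. Put $E^f(v)=\{w\mid (v,w)\in E^f\}$ and $V^f=\{v\mid E^f(v)\neq\emptyset\}\subseteq V_0$. A play is an infinite sequence $\xi$ of vertices in which consecutive ones are joined by edges; $\mathrm{Inf}(\xi)$ is the set of vertices that it visits infinitely often; $\xi$ is fair if for every $v\in V^f$, $v\in\mathrm{Inf}(\xi)$ implies $E^f(v)\subseteq\mathrm{Inf}(\xi)$. In the cofair coBüchi game $\langle G^{cf},\overline{\mathsf{Inf}}(\mathbf B)\rangle$, a play $\xi$ is won by Player 0 if it is fair and $\mathrm{Inf}(\xi)\cap\mathbf B=\emptyset$, and by Player 1 otherwise. A strategy of Player $j$ maps every finite history that ends in a vertex of $V_j$ to a successor of that vertex; $\mathsf{Win}_j$ is the set of vertices from which Player $j$ has a strategy such that all plays that follow it are won by Player $j$. Let $L=|\mathbf B|+|V^f|$ and let $[0,L]\cup\{\top\}$ be ordered in the usual way with $\top$ the largest element,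 $L+1=\top$ and $\top+1=\top$. Rankings $\rho:V\to[0,L]\cup\{\top\}$ are compared pointwise ($\preccurlyeq$). For a ranking $\rho$ put $$\mathtt{pr}_\rho(v)=\begin{cases}\min\bigl\{\max_{(v,w)\in E^f}\rho(w),\ \min_{(v,w)\in E}\rho(w)+1\bigr\}& v\in V^f\setminus\mathbf B,\\ \min_{(v,w)\in E}\rho(w)& v\in V_0\setminus(V^f\setminus\mathbf B),\\ \max_{(v,w)\in E}\rho(w)& v\in V_1,\end{cases}$$ and let $t_\rho(v)=\mathtt{pr}_\rho(v)+1$ if $v\in\mathbf B$ and $t_\rho(v)=\mathtt{pr}_\rho(v)$ if $v\notin\mathbf B$. Call $\rho$ a cofair coBüchi progress measure if $\rho(v)\ge t_\rho(v)$ for all $v\in V$. Let $\mathsf{Lift}(\rho,v)$ be the ranking that takes the value $t_\rho(v)$ at $v$ and agrees with $\rho$ at all other vertices. **Theorem.** These inequalities define valid progress measures for the game, in the following sense. 1. A ranking $\rho$ is a cofair coBüchi progress measure if and only if $\mathsf{Lift}(\rho,v)\preccurlyeq\rho$ for all $v$. 2. For each $v$, the map $\rho\mapsto\mathsf{Lift}(\rho,v)$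 is monotone; and if $\rho$ is obtained by finitely many liftings from the ranking $\rho^0$ that is constantly $0$, then $\rho\preccurlyeq\mathsf{Lift}(\rho,v)$ for all $v$. 3. There is a least ranking $\rho^*$ with $\mathsf{Lift}(\rho^*,v)=\rho^*$ for all $v$, and $\rho^*$ is also the least cofair coBüchi progress measure. If vertices are lifted one after another, starting from $\rho^0$ and in any order in which every vertex is lifted infinitely often, then from some step on the ranking is $\rho^*$. If after finitely many liftings from $\rho^0$, in any order, no lifting changes the ranking any more, then that ranking is $\rho^*$. 4. $\mathsf{Win}_0=\{v\in V\mid\rho^*(v)\neq\top\}$ and $\mathsf{Win}_1=\{v\in V\mid\rho^*(v)=\top\}$. -/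

import Mathlib

/-- A finite cofair game graph on the vertex set `V`: a directed graph whose vertices are
partitioned into Player 0 vertices `V₀` and Player 1 vertices (the complement of `V₀`), with a set
of fair edges, all of which leave Player 0 vertices.  Every vertex has a successor, so that
infinite plays never get stuck. -/
structure CofairGraph (V : Type*) where
  V₀ : Set V
  E : V → V → Prop
  Ef : V → V → Prop
  Ef_sub : ∀ v w, Ef v w → E v w
  Ef_source : ∀ v w, Ef v w → v ∈ V₀
  exists_succ : ∀ v, ∃ w, E v w

namespace CofairGraph

variable {V : Type*}

/-- The Player 1 vertices. -/
def V₁ (G : CofairGraph V) : Set V := G.V₀ᶜ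

/-- The fair vertices: those with at least one outgoing fair edge. -/
def Vf (G : CofairGraph V) : Set V := {v | ∃ w, G.Ef v w}

/-! ### Plays, strategies and winning regions -/

/-- A play: an infinite sequence of successive vertices. -/
def IsPlay (G : CofairGraph V) (ξ : ℕ → V) : Prop := ∀ i, G.E (ξ i) (ξ (i + 1))

/-- The vertices visited infinitely often. -/
def infVisited (ξ : ℕ → V) : Set V := {v | ∃ᶠ i in Filter.atTop, ξ i = v}

/-- A play is fair if, whenever a fair vertex is visited infinitely often, then so are all its fair
successors. -/
def IsFairPlay (G : CofairGraph V) (ξ : ℕ → V) : Prop :=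
  ∀ v ∈ G.Vf, v ∈ infVisited ξ → {w | G.Ef v w} ⊆ infVisited ξ

/-- The coBüchi specification: no vertex of `B` is visited infinitely often. -/
def coBuchi (B : Set V) : Set (ℕ → V) := {ξ | ∀ v ∈ B, v ∉ infVisited ξ}

/-- The sequences that Player 0 wins in the cofair game with specification `Φ`: those in `Φ` that
are fair.  All the others are won by Player 1. -/
def wonByZero (G : CofairGraph V) (Φ : Set (ℕ → V)) : Set (ℕ → V) := {ξ | ξ ∈ Φ ∧ G.IsFairPlay ξ}

/-- A strategy of the player who owns the vertices in `U`: a function of the history before the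
current vertex and of the current vertex (in `U`), which always picks a successor of the latter. -/
structure Strategy (G : CofairGraph V) (U : Set V) where
  move : List V → U → V
  legal : ∀ (h : List V) (v : U), G.E v (move h v)

/-- `ξ` is a play in which the owner of `U` follows the strategy `σ`. -/
def Strategy.IsPlayOf {G : CofairGraph V} {U : Set V} (σ : G.Strategy U) (ξ : ℕ → V) : Prop :=
  G.IsPlay ξ ∧ ∀ (i : ℕ) (hi : ξ i ∈ U), σ.move ((List.range i).map ξ) ⟨ξ i, hi⟩ = ξ (i + 1)

/-- The winning region of Player 0 in the cofair game with specification `Φ`. -/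
def Win₀ (G : CofairGraph V) (Φ : Set (ℕ → V)) : Set V :=
  {v | ∃ σ : G.Strategy G.V₀, ∀ ξ, σ.IsPlayOf ξ → ξ 0 = v → ξ ∈ G.wonByZero Φ}

/-- The winning region of Player 1 in the cofair game with specification `Φ`. -/
def Win₁ (G : CofairGraph V) (Φ : Set (ℕ → V)) : Set V :=
  {v | ∃ σ : G.Strategy G.V₁, ∀ ξ, σ.IsPlayOf ξ → ξ 0 = v → ξ ∉ G.wonByZero Φ}

end CofairGraph

/-! ### Progress measures -/

/-- The linearly ordered set `[0, L] ∪ {⊤}`. -/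
abbrev Rank (L : ℕ) : Type := WithTop (Fin (L + 1))

/-- The operation `+ 1` on `[0, L] ∪ {⊤}`, with `L + 1 = ⊤` and `⊤ + 1 = ⊤`. -/
def Rank.inc {L : ℕ} : Rank L → Rank L
  | none => ⊤
  | some i => if h : (i : ℕ) + 1 < L + 1 then ((⟨i + 1, h⟩ : Fin (L + 1)) : Rank L) else ⊤

namespace CofairGraph

variable {V : Type*} [Fintype V] {L : ℕ}

open scoped Classical in
/-- The finite set of successors of `v`; it is never empty. -/
noncomputable def succs (G : CofairGraph V) (v : V) : Finset V := {w | G.E v w}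

open scoped Classical in
/-- The finite set of fair successors of `v`; it is nonempty for `v ∈ G.Vf`. -/
noncomputable def fairSuccs (G : CofairGraph V) (v : V) : Finset V := {w | G.Ef v w}

open scoped Classical in
/-- The operator `pr`.  The maxima and minima are taken over nonempty finite sets.  Since fair
vertices belong to Player 0, the last case is that of the Player 1 vertices. -/
noncomputable def pr (G : CofairGraph V) (B : Set V) (ρ : V → Rank L) (v : V) : Rank L :=
  if v ∈ G.Vf \ B then
    min ((G.fairSuccs v).sup ρ) (Rank.inc ((G.succs v).inf ρ))
  else if v ∈ G.V₀ then
    (G.succs v).inf ρ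
  else
    (G.succs v).sup ρ

open scoped Classical in
/-- The value that is required at `v`: `pr v + 1` on `B` and `pr v` elsewhere. -/
noncomputable def target (G : CofairGraph V) (B : Set V) (ρ : V → Rank L) (v : V) : Rank L :=
  if v ∈ B then Rank.inc (G.pr B ρ v) else G.pr B ρ v

/-- The inequalities that define the cofair coBüchi progress measures. -/
def IsCofairCoBuchiPM (G : CofairGraph V) (B : Set V) (ρ : V → Rank L) : Prop :=
  ∀ v, G.target B ρ v ≤ ρ v

open scoped Classical in
/-- The lifting function: `lift ρ v` agrees with `ρ` away from `v`. -/
noncomputable def lift (G : CofairGraph V) (B : Set V) (ρ : V → Rank L) (v : V) : V → Rank L :=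
  fun w => if w = v then G.target B ρ v else ρ w

/-- The result of the first `n` liftings, at the vertices `s 0, s 1, …`, starting from the
smallest ranking, which is constantly `0`. -/
noncomputable def liftRun (G : CofairGraph V) (B : Set V) (s : ℕ → V) : ℕ → V → Rank L
  | 0 => fun _ => ((0 : Fin (L + 1)) : Rank L)
  | n + 1 => G.lift B (liftRun G B s n) (s n)

end CofairGraph

/-! Lifting is monotone on a finite lattice, so the least progress measure `ρ` exists, is the least
fixpoint and is reached by iteration; the game enters only through the winning regions. From a
finite rank Player 0 never lets the rank rise. It drops at `B` and at every other fair vertex,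
unless no fair successor ranks higher; there the fair successors are visited in rotation. The rank
finally stabilises, which excludes `B` and makes the play fair (`mem_Win₀_of_ne_top`).

For rank `⊤`, leastness is played against smaller progress measures. Merging two values shows that
`B ∪ G.Vf` attains every positive value up to an attained finite one; counting against `L` then
leaves a gap below `⊤` (`eq_top_of_le_val`), so Player 0 cannot leave rank `⊤` and Player 1 need
not. Lowering a safe set to `L` shows that it is empty (`eq_empty_of_safe`), so an attractor to `B`
covers rank `⊤`. Off `B`, the distance in it decreases by Player 1's choice, by necessity or by
fairness, so a fair play meets `B` infinitely often (`mem_Win₁_of_eq_top`). Since the winning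
regions are disjoint, both inclusions are equalities. -/

/-! ### Arithmetic of ranks -/

namespace Rank

variable {L : ℕ}

/-- The position of a rank in the linear order `0 < 1 < ⋯ < L < ⊤`. -/
def val : Rank L → ℕ
  | none => L + 1
  | some i => i

@[simp] theorem val_top : val (⊤ : Rank L) = L + 1 := rfl

@[simp] theorem val_coe (i : Fin (L + 1)) : val (i : Rank L) = i := rfl

theorem val_le (x : Rank L) : x.val ≤ L + 1 := by
  induction x using WithTop.recTopCoe with
  | top => simp
  | coe i => simp

theorem le_iff_val_le {x y : Rank L} : x ≤ y ↔ x.val ≤ y.val := by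
  induction x using WithTop.recTopCoe with
  | top =>
    induction y using WithTop.recTopCoe with
    | top => simp
    | coe j => simpa using j.2
  | coe i =>
    induction y using WithTop.recTopCoe with
    | top => simp
    | coe j => rw [WithTop.coe_le_coe, val_coe, val_coe, Fin.le_def]

theorem val_injective : Function.Injective (val : Rank L → ℕ) := fun _ _ h =>
  le_antisymm (le_iff_val_le.2 h.le) (le_iff_val_le.2 h.ge)

theorem lt_iff_val_lt {x y : Rank L} : x < y ↔ x.val < y.val := by
  rw [← not_le, ← not_le, le_iff_val_le]

theorem eq_top_iff_val {x : Rank L} : x = ⊤ ↔ x.val = L + 1 :=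
  val_injective.eq_iff.symm

theorem val_inc (x : Rank L) : (inc x).val = min (x.val + 1) (L + 1) := by
  induction x using WithTop.recTopCoe with
  | top => change L + 1 = min (L + 1 + 1) (L + 1); omega
  | coe i =>
    change val (if h : (i : ℕ) + 1 < L + 1 then ((⟨i + 1, h⟩ : Fin (L + 1)) : Rank L) else ⊤) = _
    have := i.2
    split_ifs with h
    · simp only [val_coe]; omega
    · simp only [val_coe, val_top]; omega

theorem exists_val_eq {n : ℕ} (h : n ≤ L + 1) : ∃ x : Rank L, x.val = n := by
  rcases h.lt_or_eq with h | rfl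
  · exact ⟨((⟨n, h⟩ : Fin (L + 1)) : Rank L), rfl⟩
  · exact ⟨⊤, rfl⟩

theorem inc_mono : Monotone (inc : Rank L → Rank L) := fun _ _ h => by
  rw [le_iff_val_le] at *
  rw [val_inc, val_inc]
  omega

theorem le_inc (x : Rank L) : x ≤ inc x := by
  have := x.val_le
  rw [le_iff_val_le, val_inc]
  omega

theorem lt_of_inc_le {x y : Rank L} (h : inc x ≤ y) (hy : y ≠ ⊤) : x < y := by
  have := y.val_le
  have := x.val_le
  rw [Ne, eq_top_iff_val] at hy
  rw [le_iff_val_le, val_inc] at h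
  rw [lt_iff_val_lt]
  omega

theorem zero_le (x : Rank L) : ((0 : Fin (L + 1)) : Rank L) ≤ x := by
  rw [le_iff_val_le]; exact Nat.zero_le _

/-- A map of ranks that merges the values `k` and `k - 1`. -/
theorem exists_collapse {k : ℕ} (hk : 1 ≤ k) : ∃ c : Rank L → Rank L, Monotone c ∧
    (∀ x, k ≤ x.val → x ≠ ⊤ → c x < x) ∧
    ∀ x y, x.val ≠ k → inc y ≤ x → inc (c y) ≤ c x := by
  -- Finite values from `k` on move down by one; `⊤` and the smaller values stay. Strictness is lost
  -- only between `k` and `k - 1`.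
  have hc : ∀ x : Rank L, ∃ y : Rank L,
      y.val = if k ≤ x.val ∧ x.val ≤ L then x.val - 1 else x.val := fun x => by
    apply exists_val_eq
    have := x.val_le
    split_ifs <;> omega
  choose c hc using hc
  refine ⟨c, fun x y h => ?_, fun x hx ht => ?_, fun x y hx h => ?_⟩
  · have := y.val_le
    rw [le_iff_val_le] at *
    rw [hc, hc]
    split_ifs <;> omega
  · have := x.val_le
    rw [Ne, eq_top_iff_val] at ht
    rw [lt_iff_val_lt, hc]
    split_ifs <;> omega
  · have := x.val_le
    have := y.val_le
    rw [le_iff_val_le, val_inc] at *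
    rw [hc, hc]
    split_ifs <;> omega

end Rank

/-! ### Fair vertices and the attractor of Player 1 -/

namespace CofairGraph

variable {V : Type*}

theorem Vf_subset_V₀ (G : CofairGraph V) : G.Vf ⊆ G.V₀ := fun v ⟨w, h⟩ => G.Ef_source v w h

/-- The vertices in `W` from which, for fair plays in `W`, Player 1 can make progress towards `B`
in at most `n` rounds. -/
def attractor (G : CofairGraph V) (B W : Set V) : ℕ → Set V
  | 0 => B
  | n + 1 => {v | v ∈ attractor G B W n ∨
      (v ∈ G.V₀ ∧ v ∉ G.Vf ∧ ∀ w, G.E v w → w ∈ attractor G B W n) ∨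
      (∃ w, G.Ef v w ∧ w ∈ attractor G B W n) ∨
      (v ∉ G.V₀ ∧ ∃ w ∈ W, G.E v w ∧ w ∈ attractor G B W n)}

theorem attractor_mono (G : CofairGraph V) (B W : Set V) : Monotone (G.attractor B W) :=
  monotone_nat_of_le_succ fun _ _ h => .inl h

section Ranking

variable [Fintype V] {L : ℕ} {G : CofairGraph V} {B : Set V} {ρ ρ' : V → Rank L} {v : V}

/-- The minimum is attained because successors exist; over an empty set it would be `⊤`, and the
equivalence would fail at `a = ⊤`. -/
theorem inf_succs_le_iff {a : Rank L} : (G.succs v).inf ρ ≤ a ↔ ∃ w, G.E v w ∧ ρ w ≤ a := by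
  constructor
  · intro h
    obtain ⟨u, hu⟩ := G.exists_succ v
    obtain ⟨w, hw, e⟩ := Finset.exists_mem_eq_inf (G.succs v) ⟨u, by simpa [succs] using hu⟩ ρ
    exact ⟨w, by simpa [succs] using hw, e ▸ h⟩
  · rintro ⟨w, hw, h⟩
    exact (Finset.inf_le (by simpa [succs] using hw)).trans h

/-! ### The operators `pr` and `target` -/

theorem pr_le_iff_of_fair (hv : v ∈ G.Vf) (hB : v ∉ B) {a : Rank L} : G.pr B ρ v ≤ a ↔
    (∀ w, G.Ef v w → ρ w ≤ a) ∨ ∃ w, G.E v w ∧ Rank.inc (ρ w) ≤ a := by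
  have key : Rank.inc ((G.succs v).inf ρ) ≤ a ↔ ∃ w, G.E v w ∧ Rank.inc (ρ w) ≤ a := by
    constructor
    · intro h
      obtain ⟨w, hw, e⟩ := inf_succs_le_iff.1 (le_refl ((G.succs v).inf ρ))
      exact ⟨w, hw, (Rank.inc_mono e).trans h⟩
    · rintro ⟨w, hw, h⟩
      exact (Rank.inc_mono (inf_succs_le_iff.2 ⟨w, hw, le_rfl⟩)).trans h
  rw [pr, if_pos ⟨hv, hB⟩, min_le_iff, key]
  simp [fairSuccs]

theorem pr_le_iff_of_mem_V₀ (hv : v ∈ G.V₀) (h : v ∈ G.Vf → v ∈ B) {a : Rank L} :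
    G.pr B ρ v ≤ a ↔ ∃ w, G.E v w ∧ ρ w ≤ a := by
  rw [pr, if_neg fun h' => h'.2 (h h'.1), if_pos hv, inf_succs_le_iff]

theorem pr_le_iff_of_notMem_V₀ (hv : v ∉ G.V₀) {a : Rank L} :
    G.pr B ρ v ≤ a ↔ ∀ w, G.E v w → ρ w ≤ a := by
  rw [pr, if_neg fun h => hv (G.Vf_subset_V₀ h.1), if_neg hv]
  simp [succs]

theorem pr_mono (h : ρ ≤ ρ') (v : V) : G.pr B ρ v ≤ G.pr B ρ' v := by
  have := le_refl (G.pr B ρ' v)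
  by_cases hv : v ∈ G.V₀
  · by_cases hf : v ∈ G.Vf ∧ v ∉ B
    · rw [pr_le_iff_of_fair hf.1 hf.2] at *
      exact this.imp (fun H w hw => (h w).trans (H w hw))
        fun ⟨w, hw, H⟩ => ⟨w, hw, (Rank.inc_mono (h w)).trans H⟩
    · rw [pr_le_iff_of_mem_V₀ hv (by tauto)] at *
      exact this.imp fun w H => ⟨H.1, (h w).trans H.2⟩
  · rw [pr_le_iff_of_notMem_V₀ hv] at *
    exact fun w hw => (h w).trans (this w hw)

theorem target_of_mem (h : v ∈ B) : G.target B ρ v = Rank.inc (G.pr B ρ v) := if_pos h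

theorem target_of_notMem (h : v ∉ B) : G.target B ρ v = G.pr B ρ v := if_neg h

theorem pr_le_target (v : V) : G.pr B ρ v ≤ G.target B ρ v := by
  by_cases h : v ∈ B
  · rw [target_of_mem h]; exact Rank.le_inc _
  · rw [target_of_notMem h]

theorem target_mono (h : ρ ≤ ρ') (v : V) : G.target B ρ v ≤ G.target B ρ' v := by
  by_cases hv : v ∈ B
  · rw [target_of_mem hv, target_of_mem hv]; exact Rank.inc_mono (pr_mono h v)
  · rw [target_of_notMem hv, target_of_notMem hv]; exact pr_mono h v

/-! ### Liftings -/

theorem lift_self (v : V) : G.lift B ρ v v = G.target B ρ v := if_pos rfl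

theorem lift_of_ne {w : V} (h : w ≠ v) : G.lift B ρ v w = ρ w := if_neg h

theorem lift_mono (v : V) : Monotone fun ρ : V → Rank L => G.lift B ρ v := fun ρ ρ' h w => by
  by_cases hw : w = v
  · subst hw
    simpa only [lift_self] using target_mono h w
  · simpa only [lift_of_ne hw] using h w

theorem lift_le_iff : G.lift B ρ v ≤ ρ ↔ G.target B ρ v ≤ ρ v := by
  refine ⟨fun h => lift_self (ρ := ρ) v ▸ h v, fun h w => ?_⟩
  by_cases hw : w = v
  · subst hw; rwa [lift_self]
  · rw [lift_of_ne hw]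

theorem le_lift_iff : ρ ≤ G.lift B ρ v ↔ ρ v ≤ G.target B ρ v := by
  refine ⟨fun h => lift_self (ρ := ρ) v ▸ h v, fun h w => ?_⟩
  by_cases hw : w = v
  · subst hw; rwa [lift_self]
  · rw [lift_of_ne hw]

theorem isPM_iff_lift_le : G.IsCofairCoBuchiPM B ρ ↔ ∀ v, G.lift B ρ v ≤ ρ :=
  forall_congr' fun _ => lift_le_iff.symm

/-- The invariant `ρ ≤ target ρ` holds at the bottom ranking and survives a lifting, because the
ranking grows and `target` is monotone. -/
theorem liftRun_le_lift (s : ℕ → V) (n : ℕ) (v : V) :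
    (G.liftRun B s n : V → Rank L) ≤ G.lift B (G.liftRun B s n) v := by
  induction n generalizing v with
  | zero => exact le_lift_iff.2 (Rank.zero_le _)
  | succ n ih =>
    have hle : (G.liftRun B s n : V → Rank L) ≤ G.liftRun B s (n + 1) := ih (s n)
    rw [le_lift_iff]
    refine le_trans ?_ (target_mono hle v)
    change G.lift B (G.liftRun B s n) (s n) v ≤ _
    by_cases hv : v = s n
    · rw [hv, lift_self]
    · rw [lift_of_ne hv]
      exact le_lift_iff.1 (ih v)

theorem liftRun_le_of_isPM (h : G.IsCofairCoBuchiPM B ρ) (s : ℕ → V) (n : ℕ) :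
    G.liftRun B s n ≤ ρ := by
  induction n with
  | zero => exact fun _ => Rank.zero_le _
  | succ n ih => exact (lift_mono (s n) ih).trans (isPM_iff_lift_le.1 h _)

/-! ### The least progress measure -/

variable (G B L) in
theorem exists_isLeast_isPM : ∃ ρ : V → Rank L, IsLeast {ρ | G.IsCofairCoBuchiPM B ρ} ρ := by
  classical
  let S : Finset (V → Rank L) := Finset.univ.filter (G.IsCofairCoBuchiPM B)
  have hle : ∀ ρ, G.IsCofairCoBuchiPM B ρ → (fun v => S.inf fun ρ => ρ v) ≤ ρ := fun ρ h v =>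
    Finset.inf_le (f := fun ρ : V → Rank L => ρ v) (by simpa [S] using h)
  exact ⟨fun v => S.inf fun ρ => ρ v,
    fun v => Finset.le_inf fun ρ hρ =>
      (target_mono (hle ρ (by simpa [S] using hρ)) v).trans ((by simpa [S] using hρ :
        G.IsCofairCoBuchiPM B ρ) v), hle⟩

theorem isPM_of_lift_eq (h : ∀ v, G.lift B ρ v = ρ) : G.IsCofairCoBuchiPM B ρ :=
  isPM_iff_lift_le.2 fun v => (h v).le

/-- As in Knaster–Tarski, `target ρ` is itself a progress measure by monotonicity, so leastness
bounds `ρ` by it. -/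
theorem target_eq_of_isLeast (h : IsLeast {ρ | G.IsCofairCoBuchiPM B ρ} ρ) (v : V) :
    G.target B ρ v = ρ v :=
  le_antisymm (h.1 v) (mem_lowerBounds.1 h.2 (G.target B ρ) (fun w => target_mono h.1 w) v)

theorem isLeast_lift_eq_of_isLeast (h : IsLeast {ρ | G.IsCofairCoBuchiPM B ρ} ρ) :
    IsLeast {ρ | ∀ v, G.lift B ρ v = ρ} ρ :=
  ⟨fun v => le_antisymm (lift_le_iff.2 (h.1 v)) (le_lift_iff.2 (target_eq_of_isLeast h v).ge),
    fun _ h' => h.2 (isPM_of_lift_eq h')⟩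

theorem liftRun_eq_of_isLeast (h : IsLeast {ρ | G.IsCofairCoBuchiPM B ρ} ρ) (s : ℕ → V) (n : ℕ)
    (hn : ∀ v, G.lift B (G.liftRun B s n : V → Rank L) v = G.liftRun B s n) :
    G.liftRun B s n = ρ :=
  le_antisymm (liftRun_le_of_isPM h.1 s n) (h.2 (isPM_of_lift_eq hn))

/-- An increasing chain in a finite order stabilises; every vertex is lifted again later without
effect, so the limit is a fixpoint. -/
theorem eventually_liftRun_eq (h : IsLeast {ρ | G.IsCofairCoBuchiPM B ρ} ρ) (s : ℕ → V)
    (hs : ∀ v, ∃ᶠ n in Filter.atTop, s n = v) :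
    ∀ᶠ n in Filter.atTop, G.liftRun B s n = ρ := by
  have hm : Monotone fun n => (G.liftRun B s n : V → Rank L) :=
    monotone_nat_of_le_succ fun n => liftRun_le_lift s n (s n)
  obtain ⟨N, hN⟩ := WellFoundedGT.monotone_chain_condition ⟨_, hm⟩
  have hN' : ∀ n, N ≤ n → (G.liftRun B s n : V → Rank L) = G.liftRun B s N :=
    fun n hn => (hN n hn).symm
  have hfix := liftRun_eq_of_isLeast h s N fun v => by
    obtain ⟨n, hn, rfl⟩ := Filter.frequently_atTop.1 (hs v) N
    calc G.lift B (G.liftRun B s N) (s n) = G.liftRun B s (n + 1) := by rw [← hN' n hn]; rfl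
      _ = _ := hN' _ (by omega)
  filter_upwards [Filter.eventually_ge_atTop N] with n hn
  rw [hN' n hn, hfix]

/-! ### Finite ranks suffice -/

/-- Every value `k` below a finite value of the least progress measure is attained at a vertex that
is fair or belongs to `B`. -/
theorem exists_val_eq_of_isLeast (h : IsLeast {ρ | G.IsCofairCoBuchiPM B ρ} ρ) {k : ℕ}
    (hk : 1 ≤ k) (hv : k ≤ (ρ v).val) (ht : ρ v ≠ ⊤) : ∃ u ∈ B ∪ G.Vf, (ρ u).val = k := by
  by_contra! hu
  obtain ⟨c, hc, hlt, hinc⟩ := Rank.exists_collapse (L := L) hk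
  -- Increments occur only at `B` and at fair vertices, which avoid the value `k`; so `c ∘ ρ` is
  -- still a progress measure, yet smaller at `v`.
  refine (hlt _ hv ht).not_ge (mem_lowerBounds.1 h.2 (c ∘ ρ) (fun w => ?_) v)
  have hp := h.1 w
  by_cases hB : w ∈ B
  · rw [target_of_mem hB] at *
    refine le_trans (Rank.inc_mono ?_) (hinc _ _ (hu w (.inl hB)) hp)
    have := le_refl (G.pr B ρ w)
    by_cases h0 : w ∈ G.V₀
    · rw [pr_le_iff_of_mem_V₀ h0 fun _ => hB] at *
      exact this.imp fun u H => ⟨H.1, hc H.2⟩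
    · rw [pr_le_iff_of_notMem_V₀ h0] at *
      exact fun u H => hc (this u H)
  · rw [target_of_notMem hB] at *
    by_cases h0 : w ∈ G.V₀
    · by_cases hf : w ∈ G.Vf
      · rw [pr_le_iff_of_fair hf hB] at *
        exact hp.imp (fun H u e => hc (H u e))
          fun ⟨u, e, H⟩ => ⟨u, e, hinc _ _ (hu w (.inr hf)) H⟩
      · rw [pr_le_iff_of_mem_V₀ h0 fun hf' => absurd hf' hf] at *
        exact hp.imp fun u H => ⟨H.1, hc H.2⟩
    · rw [pr_le_iff_of_notMem_V₀ h0] at *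
      exact fun u H => hc (hp u H)

/-- If the least progress measure takes the value `⊤`, then it does not take the value `L`. -/
theorem eq_top_of_le_val (hL : L = B.ncard + G.Vf.ncard)
    (h : IsLeast {ρ | G.IsCofairCoBuchiPM B ρ} ρ) {u : V} (hu : ρ u = ⊤)
    (hv : L ≤ (ρ v).val) : ρ v = ⊤ := by
  by_contra ht
  have hfin : ∀ x ∈ B ∪ G.Vf, ρ x ≠ ⊤ := by
    intro x hx hxt
    -- Pigeonhole: the `L + 1` values from `1` to `L` and `⊤` would be taken on a set of at most `L`
    -- vertices.
    have hsub : (Finset.Icc 1 (L + 1) : Set ℕ) ⊆ (fun x => (ρ x).val) '' (B ∪ G.Vf) := by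
      intro k hk
      simp only [Finset.coe_Icc, Set.mem_Icc] at hk
      rcases hk.2.lt_or_eq with h' | rfl
      · exact exists_val_eq_of_isLeast h hk.1 (by omega) ht
      · exact ⟨x, hx, by simp [hxt]⟩
    have h1 := Set.ncard_le_ncard hsub (Set.toFinite _)
    have h2 := Set.ncard_image_le (f := fun x => (ρ x).val) (Set.toFinite (B ∪ G.Vf))
    have h3 := Set.ncard_union_le B G.Vf
    rw [Set.ncard_coe_finset, Nat.card_Icc] at h1
    omega
  refine ht (top_le_iff.1 ?_)
  have hmax : ∀ x, ρ x ≠ ⊤ → ρ x ≤ ρ v := fun x hx => by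
    have := (ρ x).val_le
    rw [Ne, Rank.eq_top_iff_val] at hx
    rw [Rank.le_iff_val_le]
    omega
  -- Truncation at `ρ v`, the largest finite rank, only lowers vertices outside `B ∪ G.Vf`, where no
  -- increment is required.
  have hpm : G.IsCofairCoBuchiPM B fun x => min (ρ x) (ρ v) := fun x => by
    by_cases hx : ρ x = ⊤
    · have hx' : x ∉ B ∪ G.Vf := fun hx' => hfin x hx' hx
      have hle : min (ρ x) (ρ v) = ρ v := by simp [hx]
      dsimp only
      rw [target_of_notMem fun hB => hx' (.inl hB), hle]
      by_cases h0 : x ∈ G.V₀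
      · rw [pr_le_iff_of_mem_V₀ h0 fun hf => absurd (.inr hf) hx']
        exact (G.exists_succ x).imp fun w hw => ⟨hw, min_le_right _ _⟩
      · rw [pr_le_iff_of_notMem_V₀ h0]
        exact fun w _ => min_le_right _ _
    · dsimp only
      rw [show min (ρ x) (ρ v) = ρ x from min_eq_left (hmax x hx)]
      exact (target_mono (fun w => min_le_left _ _) x).trans (h.1 x)
  exact hu.symm.le.trans ((h.2 hpm u).trans (min_le_right _ _))

/-- Only `L` and `⊤` increment to `⊤`, and the gap excludes `L`. -/
theorem eq_top_of_inc_eq_top (hL : L = B.ncard + G.Vf.ncard)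
    (h : IsLeast {ρ | G.IsCofairCoBuchiPM B ρ} ρ) {u : V} (hu : ρ u = ⊤)
    (hv : Rank.inc (ρ v) = ⊤) : ρ v = ⊤ := by
  rw [Rank.eq_top_iff_val, Rank.val_inc] at hv
  exact eq_top_of_le_val hL h hu (by omega)

/-- Player 0 cannot leave the set of vertices of rank `⊤`. -/
theorem eq_top_of_succ (hL : L = B.ncard + G.Vf.ncard)
    (h : IsLeast {ρ | G.IsCofairCoBuchiPM B ρ} ρ) (hv : ρ v = ⊤) (h0 : v ∈ G.V₀) {w : V}
    (hw : G.E v w) : ρ w = ⊤ := by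
  refine eq_top_of_inc_eq_top hL h hv (top_le_iff.1 ?_)
  rw [← hv, ← target_eq_of_isLeast h v]
  by_cases hB : v ∈ B
  · rw [target_of_mem hB]
    exact Rank.inc_mono ((pr_le_iff_of_mem_V₀ h0 fun _ => hB).2 ⟨w, hw, le_rfl⟩)
  · rw [target_of_notMem hB]
    by_cases hf : v ∈ G.Vf
    · exact (pr_le_iff_of_fair hf hB).2 (.inr ⟨w, hw, le_rfl⟩)
    · exact (pr_le_iff_of_mem_V₀ h0 fun hf' => absurd hf' hf).2 ⟨w, hw, Rank.le_inc _⟩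

/-- Player 1 can stay in the set of vertices of rank `⊤`. -/
theorem exists_succ_eq_top (hL : L = B.ncard + G.Vf.ncard)
    (h : IsLeast {ρ | G.IsCofairCoBuchiPM B ρ} ρ) (hv : ρ v = ⊤) :
    ∃ w, G.E v w ∧ ρ w = ⊤ := by
  by_cases h0 : v ∈ G.V₀
  · exact (G.exists_succ v).imp fun w hw => ⟨hw, eq_top_of_succ hL h hv h0 hw⟩
  obtain ⟨w, hw, e⟩ : ∃ w, G.E v w ∧ G.pr B ρ v ≤ ρ w := by
    obtain ⟨u, hu⟩ := G.exists_succ v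
    obtain ⟨w, hw, e⟩ := Finset.exists_max_image (G.succs v) ρ ⟨u, by simpa [succs] using hu⟩
    exact ⟨w, by simpa [succs] using hw,
      (pr_le_iff_of_notMem_V₀ h0).2 fun x hx => e x (by simpa [succs] using hx)⟩
  refine ⟨w, hw, eq_top_of_inc_eq_top hL h hv (top_le_iff.1 ?_)⟩
  rw [← hv, ← target_eq_of_isLeast h v]
  by_cases hB : v ∈ B
  · rw [target_of_mem hB]
    exact Rank.inc_mono e
  · rw [target_of_notMem hB]
    exact e.trans (Rank.le_inc _)

/-- There is no nonempty set of vertices of rank `⊤` in which Player 0 can avoid `B` and be fair. -/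
theorem eq_empty_of_safe (h : IsLeast {ρ | G.IsCofairCoBuchiPM B ρ} ρ) {U : Set V}
    (hU : ∀ v ∈ U, ρ v = ⊤) (hB : ∀ v ∈ U, v ∉ B)
    (h0 : ∀ v ∈ U, v ∈ G.V₀ → v ∉ G.Vf → ∃ w ∈ U, G.E v w)
    (hf : ∀ v ∈ U, ∀ w, G.Ef v w → w ∈ U)
    (h1 : ∀ v ∈ U, v ∉ G.V₀ → ∀ w, G.E v w → w ∈ U ∨ ρ w ≠ ⊤) : U = ∅ := by
  classical
  obtain ⟨m, hm⟩ := Rank.exists_val_eq (L := L) (n := L) (by omega)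
  have hmt : m < ⊤ := by rw [Rank.lt_iff_val_lt, hm, Rank.val_top]; omega
  have hle : ∀ x, ρ x ≠ ⊤ → ρ x ≤ m := fun x hx => by
    have := (ρ x).val_le
    rw [Ne, Rank.eq_top_iff_val] at hx
    rw [Rank.le_iff_val_le]
    omega
  -- Lowering `U` from `⊤` to `L` costs nothing: the edges that matter inside `U` end in `U` or at
  -- finite ranks, all at most `L`, and elsewhere monotonicity suffices.
  set ρ' : V → Rank L := fun x => if x ∈ U then m else ρ x with hρ'
  have hin : ∀ x ∈ U, ρ' x = m := fun x hx => if_pos hx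
  have hout : ∀ x, x ∉ U → ρ' x = ρ x := fun x hx => if_neg hx
  have hle' : ρ' ≤ ρ := fun x => by
    by_cases hx : x ∈ U
    · rw [hU x hx]; exact le_top
    · rw [hout x hx]
  have hpm : G.IsCofairCoBuchiPM B ρ' := fun x => by
    by_cases hx : x ∈ U
    · rw [target_of_notMem (hB x hx), hin x hx]
      by_cases hx0 : x ∈ G.V₀
      · by_cases hxf : x ∈ G.Vf
        · exact (pr_le_iff_of_fair hxf (hB x hx)).2 (.inl fun w hw => (hin w (hf x hx w hw)).le)
        · obtain ⟨w, hw, e⟩ := h0 x hx hx0 hxf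
          exact (pr_le_iff_of_mem_V₀ hx0 fun hf' => absurd hf' hxf).2 ⟨w, e, (hin w hw).le⟩
      · refine (pr_le_iff_of_notMem_V₀ hx0).2 fun w hw => ?_
        by_cases hwU : w ∈ U
        · exact (hin w hwU).le
        · rw [hout w hwU]
          exact hle w ((h1 x hx hx0 w hw).resolve_left hwU)
    · rw [hout x hx]
      exact (target_mono hle' x).trans (h.1 x)
  refine Set.eq_empty_of_forall_notMem fun x hx => ?_
  have := h.2 hpm x
  rw [hU x hx, hin x hx] at this
  exact hmt.not_ge this

/-! ### The strategy of Player 0 -/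

/-- The fair vertices at which a ranking allows Player 0 to visit all fair successors in turn. -/
def rotating (G : CofairGraph V) (ρ : V → Rank L) : Set V :=
  {v | v ∈ G.Vf ∧ ∀ w, G.Ef v w → ρ w ≤ ρ v}

/-- Outside the rotating case a single edge witnesses the inequality; the increment, from `target`
on `B` or from `pr` at fair vertices, makes the descent strict at finite ranks. -/
theorem exists_descending_succ (h : G.IsCofairCoBuchiPM B ρ) (h0 : v ∈ G.V₀)
    (hr : v ∉ B → v ∉ G.rotating ρ) :
    ∃ w, G.E v w ∧ ρ w ≤ ρ v ∧ (v ∈ B ∪ G.Vf → ρ v ≠ ⊤ → ρ w < ρ v) := by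
  have hv := h v
  by_cases hB : v ∈ B
  · rw [target_of_mem hB] at hv
    obtain ⟨w, hw, e⟩ := (pr_le_iff_of_mem_V₀ h0 fun _ => hB).1 (le_refl (G.pr B ρ v))
    have := (Rank.inc_mono e).trans hv
    exact ⟨w, hw, (Rank.le_inc _).trans this, fun _ ht => Rank.lt_of_inc_le this ht⟩
  · rw [target_of_notMem hB] at hv
    by_cases hf : v ∈ G.Vf
    · obtain H | ⟨w, hw, e⟩ := (pr_le_iff_of_fair hf hB).1 hv
      · exact absurd ⟨hf, H⟩ (hr hB)
      · exact ⟨w, hw, (Rank.le_inc _).trans e, fun _ ht => Rank.lt_of_inc_le e ht⟩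
    · obtain ⟨w, hw, e⟩ := (pr_le_iff_of_mem_V₀ h0 fun hf' => absurd hf' hf).1 hv
      exact ⟨w, hw, e, fun hv' => absurd hv' (by simp [hB, hf])⟩

theorem le_of_succ_of_notMem_V₀ (h : G.IsCofairCoBuchiPM B ρ) (h0 : v ∉ G.V₀) {w : V}
    (hw : G.E v w) : ρ w ≤ ρ v ∧ (v ∈ B → ρ v ≠ ⊤ → ρ w < ρ v) := by
  have hp := (pr_le_iff_of_notMem_V₀ h0).1 (le_refl (G.pr B ρ v)) w hw
  refine ⟨hp.trans ((pr_le_target v).trans (h v)), fun hB ht => ?_⟩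
  exact Rank.lt_of_inc_le ((Rank.inc_mono hp).trans (target_of_mem (ρ := ρ) hB ▸ h v)) ht

/-- The first coordinate of the pairing function repeats every index of an enumeration of `S`
infinitely often. -/
theorem exists_rotation {α : Type*} [Countable α] {S : Set α} (hS : S.Nonempty) :
    ∃ f : ℕ → α, (∀ n, f n ∈ S) ∧ ∀ w ∈ S, ∃ᶠ n in Filter.atTop, f n = w := by
  have := hS.to_subtype
  obtain ⟨g, hg⟩ := exists_surjective_nat S
  refine ⟨fun n => g n.unpair.1, fun n => (g _).2,
    fun w hw => Filter.frequently_atTop.2 fun N => ?_⟩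
  obtain ⟨k, hk⟩ := hg ⟨w, hw⟩
  exact ⟨Nat.pair k N, Nat.right_le_pair k N, by simp [hk]⟩

open scoped Classical in
/-- A strategy that never increases the rank, decreases it at the vertices in `B` and at the fair
vertices that are not rotating, and visits all fair successors of each rotating vertex in turn. -/
theorem exists_rotating_strategy (h : G.IsCofairCoBuchiPM B ρ) :
    ∃ (σ : G.Strategy G.V₀) (f : V → ℕ → V),
      (∀ v ∈ G.rotating ρ, ∀ w, G.Ef v w → ∃ᶠ n in Filter.atTop, f v n = w) ∧
      ∀ (l : List V) (v : G.V₀), ρ (σ.move l v) ≤ ρ v ∧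
        (v.1 ∈ B → ρ v ≠ ⊤ → ρ (σ.move l v) < ρ v) ∧
        (v.1 ∉ B → v.1 ∈ G.Vf → ρ v ≠ ⊤ → ρ (σ.move l v) < ρ v ∨
          v.1 ∈ G.rotating ρ ∧ σ.move l v = f v (l.count v.1)) := by
  have hf : ∀ v : V, ∃ f : ℕ → V, v ∈ G.rotating ρ →
      (∀ n, G.Ef v (f n)) ∧ ∀ w, G.Ef v w → ∃ᶠ n in Filter.atTop, f n = w := fun v => by
    by_cases hv : v ∈ G.rotating ρ
    · obtain ⟨f, hf⟩ := exists_rotation (S := {w | G.Ef v w}) hv.1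
      exact ⟨f, fun _ => hf⟩
    · exact ⟨fun _ => v, fun h => absurd h hv⟩
  choose f hf using hf
  have hm : ∀ (l : List V) (v : G.V₀), ∃ w, G.E v w ∧ ρ w ≤ ρ v ∧
      (v.1 ∈ B → ρ v ≠ ⊤ → ρ w < ρ v) ∧
      (v.1 ∉ B → v.1 ∈ G.Vf → ρ v ≠ ⊤ → ρ w < ρ v ∨
        v.1 ∈ G.rotating ρ ∧ w = f v (l.count v.1)) := fun l v => by
    by_cases hr : v.1 ∉ B ∧ v.1 ∈ G.rotating ρ
    · have he := (hf v hr.2).1 (l.count v.1)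
      exact ⟨_, G.Ef_sub _ _ he, hr.2.2 _ he, fun hB => absurd hB hr.1,
        fun _ _ _ => .inr ⟨hr.2, rfl⟩⟩
    · obtain ⟨w, hw, hle, hlt⟩ := exists_descending_succ h v.2 fun hB hr' => hr ⟨hB, hr'⟩
      exact ⟨w, hw, hle, fun hB => hlt (.inl hB), fun _ hv ht => .inl (hlt (.inr hv) ht)⟩
  choose m hm using hm
  exact ⟨⟨m, fun l v => (hm l v).1⟩, f, fun v hv => (hf v hv).2, fun l v => (hm l v).2⟩

open scoped Classical in
theorem count_map_range {α : Type*} (ξ : ℕ → α) (v : α) (i : ℕ) :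
    ((List.range i).map ξ).count v = Nat.count (fun j => ξ j = v) i := by
  induction i with
  | zero => simp
  | succ i ih =>
    rw [List.range_succ, List.map_append, List.count_append, ih, Nat.count_succ]
    simp [List.count_singleton]

theorem mem_Win₀_of_ne_top (h : G.IsCofairCoBuchiPM B ρ) (hv : ρ v ≠ ⊤) :
    v ∈ G.Win₀ (coBuchi B) := by
  classical
  obtain ⟨σ, f, hf, hσ⟩ := exists_rotating_strategy h
  refine ⟨σ, fun ξ ⟨hplay, hmove⟩ hξ0 => ?_⟩
  have hanti : Antitone fun i => ρ (ξ i) := antitone_nat_of_succ_le fun i => by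
    by_cases h0 : ξ i ∈ G.V₀
    · rw [← hmove i h0]; exact (hσ _ ⟨ξ i, h0⟩).1
    · exact (le_of_succ_of_notMem_V₀ h h0 (hplay i)).1
  have htop : ∀ i, ρ (ξ i) ≠ ⊤ := fun i =>
    ne_top_of_le_ne_top (by simpa only [hξ0] using hv) (hanti (Nat.zero_le i))
  obtain ⟨N, hN⟩ := WellFoundedLT.antitone_chain_condition hanti
  have hconst : ∀ i, N ≤ i → ¬ ρ (ξ (i + 1)) < ρ (ξ i) := fun i hi => by
    have h1 : ρ (ξ N) = ρ (ξ i) := hN i hi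
    have h2 : ρ (ξ N) = ρ (ξ (i + 1)) := hN (i + 1) (by omega)
    rw [← h1, ← h2]
    exact lt_irrefl _
  have hB : ∀ i, N ≤ i → ξ i ∉ B := fun i hi hB => hconst i hi <| by
    by_cases h0 : ξ i ∈ G.V₀
    · rw [← hmove i h0]; exact (hσ _ ⟨ξ i, h0⟩).2.1 hB (htop i)
    · exact (le_of_succ_of_notMem_V₀ h h0 (hplay i)).2 hB (htop i)
  refine ⟨fun u hu hinf => ?_, fun u hu hinf w hw => ?_⟩
  · obtain ⟨i, hi, rfl⟩ := Filter.frequently_atTop.1 hinf N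
    exact hB i hi hu
  · have h0 : u ∈ G.V₀ := G.Vf_subset_V₀ hu
    have hmv : ∀ i, N ≤ i → ξ i = u → u ∈ G.rotating ρ ∧
        ξ (i + 1) = f u (Nat.count (fun j => ξ j = u) i) := fun i hi e => by
      subst e
      have := (hσ ((List.range i).map ξ) ⟨ξ i, h0⟩).2.2 (hB i hi) hu (htop i)
      rw [hmove i h0, count_map_range] at this
      exact this.resolve_left (hconst i hi)
    obtain ⟨i, hi, e⟩ := Filter.frequently_atTop.1 hinf N
    have hrot := hf u (hmv i hi e).1 w hw
    have hinf' : {i | ξ i = u}.Infinite := Nat.frequently_atTop_iff_infinite.1 hinf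
    refine Filter.frequently_atTop.2 fun M => ?_
    obtain ⟨n, hn, rfl⟩ := Filter.frequently_atTop.1 hrot (max M N)
    -- The visit to `u` with exactly `n` predecessors happens at time at least `n`, hence after `M`
    -- and `N`, and `f u n` comes next.
    have hc := Nat.count_nth_of_infinite hinf' n
    have hi : n ≤ Nat.nth (fun j => ξ j = u) n := by
      conv_lhs => rw [← hc]
      exact Nat.count_le _
    refine ⟨Nat.nth (fun j => ξ j = u) n + 1, by omega, ?_⟩
    rw [(hmv _ (by omega) (Nat.nth_mem_of_infinite hinf' n)).2, hc]

/-! ### The strategy of Player 1 -/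

/-- The vertices of rank `⊤` that the attractor misses form a safe set, which must be empty. -/
theorem exists_mem_attractor (hL : L = B.ncard + G.Vf.ncard)
    (h : IsLeast {ρ | G.IsCofairCoBuchiPM B ρ} ρ) (hv : ρ v = ⊤) :
    ∃ n, v ∈ G.attractor B {w | ρ w = ⊤} n := by
  by_contra hvn
  set A := G.attractor B {w | ρ w = ⊤} with hA
  have hU := eq_empty_of_safe h (U := {u | ρ u = ⊤ ∧ ¬ ∃ n, u ∈ A n}) (fun u hu => hu.1)
    (fun u hu hB => hu.2 ⟨0, hB⟩) ?_ ?_ ?_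
  · exact (Set.eq_empty_iff_forall_notMem.1 hU v) ⟨hv, hvn⟩
  · rintro u ⟨hut, hu⟩ h0 hf
    by_contra! hw
    have hex : ∀ w, ∃ n, G.E u w → w ∈ A n := fun w => by
      by_cases e : G.E u w
      · by_contra hn
        exact hw w ⟨eq_top_of_succ hL h hut h0 e, fun n hn' => hn ⟨n, fun _ => hn'⟩⟩ e
      · exact ⟨0, fun e' => absurd e' e⟩
    choose n hn using hex
    exact hu ⟨Finset.univ.sup n + 1, .inr (.inl ⟨h0, hf, fun w e =>
      G.attractor_mono B _ (Finset.le_sup (Finset.mem_univ w)) (hn w e)⟩)⟩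
  · rintro u ⟨hut, hu⟩ w e
    exact ⟨eq_top_of_succ hL h hut (G.Ef_source _ _ e) (G.Ef_sub _ _ e),
      fun ⟨n, hn⟩ => hu ⟨n + 1, .inr (.inr (.inl ⟨w, e, hn⟩))⟩⟩
  · rintro u ⟨hut, hu⟩ h0 w e
    by_cases hwt : ρ w = ⊤
    · exact .inl ⟨hwt, fun ⟨n, hn⟩ => hu ⟨n + 1, .inr (.inr (.inr ⟨h0, w, hwt, e, hn⟩))⟩⟩
    · exact .inr hwt

theorem exists_distance (hL : L = B.ncard + G.Vf.ncard)
    (h : IsLeast {ρ | G.IsCofairCoBuchiPM B ρ} ρ) :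
    ∃ d : V → ℕ, ∀ v, ρ v = ⊤ → v ∉ B →
      (v ∈ G.V₀ → v ∉ G.Vf → ∀ w, G.E v w → d w < d v) ∧
      (v ∈ G.Vf → ∃ w, G.Ef v w ∧ d w < d v) ∧
      (v ∉ G.V₀ → ∃ w, G.E v w ∧ ρ w = ⊤ ∧ d w < d v) := by
  classical
  set A := G.attractor B {w | ρ w = ⊤} with hA
  -- The distance is the first stage containing the vertex. The default `0` outside all stages is
  -- harmless: only members of the attractor are compared.
  refine ⟨fun v => sInf {n | v ∈ A n}, fun v hv hB => ?_⟩
  have hmem : v ∈ A (sInf {n | v ∈ A n}) := Nat.sInf_mem (exists_mem_attractor hL h hv)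
  have hle : ∀ {w n}, w ∈ A n → sInf {n | w ∈ A n} ≤ n := fun hw => Nat.sInf_le hw
  dsimp only
  generalize hk : sInf {n | v ∈ A n} = k at hmem
  cases k with
  | zero => exact absurd hmem hB
  | succ k =>
    have hlt : ∀ {w}, w ∈ A k → sInf {n | w ∈ A n} < k + 1 := fun hw =>
      Nat.lt_succ_of_le (hle hw)
    obtain H | ⟨h0, hf, H⟩ | ⟨w, e, H⟩ | ⟨h0, w, hwt, e, H⟩ := hmem
    · have := hle H
      omega
    · exact ⟨fun _ _ w e => hlt (H w e), fun hf' => absurd hf' hf, fun h0' => absurd h0 h0'⟩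
    · have hf : v ∈ G.Vf := ⟨w, e⟩
      exact ⟨fun _ hf' => absurd hf hf', fun _ => ⟨w, e, hlt H⟩,
        fun h0 => absurd (G.Vf_subset_V₀ hf) h0⟩
    · exact ⟨fun h0' => absurd h0' h0, fun hf => absurd (G.Vf_subset_V₀ hf) h0,
        fun _ => ⟨w, e, hwt, hlt H⟩⟩

theorem infVisited_nonempty (ξ : ℕ → V) : (infVisited ξ).Nonempty := by
  obtain ⟨v, hv⟩ := Finite.exists_infinite_fiber ξ
  exact ⟨v, Nat.frequently_atTop_iff_infinite.2 (Set.infinite_coe_iff.1 hv)⟩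

theorem exists_mem_infVisited_of_frequently {ξ : ℕ → V} {P : V → Prop}
    (h : ∃ᶠ i in Filter.atTop, P (ξ i)) : ∃ v ∈ infVisited ξ, P v := by
  by_contra! hn
  have : ∀ᶠ i in Filter.atTop, ∀ v, P v → ξ i ≠ v := Filter.eventually_all.2 fun v => by
    by_cases hv : P v
    · have := Filter.not_frequently.1 fun h' => hn v h' hv
      exact this.mono fun i hi _ => hi
    · exact .of_forall fun i hv' => absurd hv' hv
  obtain ⟨i, hi, hi'⟩ := (h.and_eventually this).exists
  exact hi' _ hi rfl

theorem mem_Win₁_of_eq_top (hL : L = B.ncard + G.Vf.ncard)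
    (h : IsLeast {ρ | G.IsCofairCoBuchiPM B ρ} ρ) (hv : ρ v = ⊤) :
    v ∈ G.Win₁ (coBuchi B) := by
  obtain ⟨d, hd⟩ := exists_distance hL h
  have hm : ∀ v : G.V₁, ∃ w, G.E v w ∧ (ρ v = ⊤ → ρ w = ⊤ ∧ (v.1 ∉ B → d w < d v)) := by
    rintro ⟨v, h0⟩
    by_cases ht : ρ v = ⊤
    · by_cases hB : v ∈ B
      · obtain ⟨w, hw, e⟩ := exists_succ_eq_top hL h ht
        exact ⟨w, hw, fun _ => ⟨e, fun hB' => absurd hB hB'⟩⟩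
      · obtain ⟨w, hw, e, hlt⟩ := (hd v ht hB).2.2 h0
        exact ⟨w, hw, fun _ => ⟨e, fun _ => hlt⟩⟩
    · exact (G.exists_succ v).imp fun w hw => ⟨hw, fun ht' => absurd ht' ht⟩
  choose m hm using hm
  refine ⟨⟨fun _ => m, fun _ v => (hm v).1⟩, fun ξ ⟨hplay, hmove⟩ hξ0 ⟨hcb, hfair⟩ => ?_⟩
  have htop : ∀ i, ρ (ξ i) = ⊤ := fun i => by
    induction i with
    | zero => rw [hξ0, hv]
    | succ i ih =>
      by_cases h0 : ξ i ∈ G.V₀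
      · exact eq_top_of_succ hL h ih h0 (hplay i)
      · rw [← hmove i h0]; exact ((hm ⟨ξ i, h0⟩).2 ih).1
  -- A vertex visited infinitely often at minimal distance lies outside `B`, so it yields a closer
  -- one that recurs too.
  obtain ⟨u, hu, hmin⟩ := Set.exists_min_image _ d (Set.toFinite _) (infVisited_nonempty ξ)
  have hB : u ∉ B := fun hB => hcb u hB hu
  have hut : ρ u = ⊤ := by
    obtain ⟨i, rfl⟩ := Filter.Frequently.exists hu
    exact htop i
  suffices ∃ w ∈ infVisited ξ, d w < d u by
    obtain ⟨w, hw, hlt⟩ := this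
    exact (hmin w hw).not_gt hlt
  by_cases hf : u ∈ G.Vf
  · obtain ⟨w, e, hlt⟩ := (hd u hut hB).2.1 hf
    exact ⟨w, hfair u hf hu e, hlt⟩
  · have hstep : ∃ᶠ i in Filter.atTop, d (ξ (i + 1)) < d u := Filter.Frequently.mono hu <| by
      rintro i rfl
      by_cases h0 : ξ i ∈ G.V₀
      · exact (hd _ hut hB).1 h0 hf _ (hplay i)
      · rw [← hmove i h0]; exact ((hm ⟨ξ i, h0⟩).2 hut).2 hB
    exact exists_mem_infVisited_of_frequently (P := fun w => d w < d u)
      ((Filter.tendsto_add_atTop_nat 1).frequently hstep)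

end Ranking

/-! ### The two players cannot both win -/

open scoped Classical in
/-- The history of the play in which both players follow their strategies: the list of the vertices
visited before the current one, and the current vertex. -/
noncomputable def jointHistory {G : CofairGraph V} (σ : G.Strategy G.V₀) (τ : G.Strategy G.V₁)
    (v : V) : ℕ → List V × V
  | 0 => ([], v)
  | n + 1 =>
    let p := jointHistory σ τ v n
    (p.1 ++ [p.2], if h : p.2 ∈ G.V₀ then σ.move p.1 ⟨p.2, h⟩ else τ.move p.1 ⟨p.2, h⟩)

open scoped Classical in
theorem exists_joint_play {G : CofairGraph V} (σ : G.Strategy G.V₀) (τ : G.Strategy G.V₁) (v : V) :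
    ∃ ξ, σ.IsPlayOf ξ ∧ τ.IsPlayOf ξ ∧ ξ 0 = v := by
  set ξ : ℕ → V := fun n => (jointHistory σ τ v n).2 with hξ
  have hhist : ∀ n, (jointHistory σ τ v n).1 = (List.range n).map ξ := fun n => by
    induction n with
    | zero => rfl
    | succ n ih =>
      rw [List.range_succ, List.map_append, ← ih]
      rfl
  have hstep : ∀ i, ξ (i + 1) = if h : ξ i ∈ G.V₀ then σ.move ((List.range i).map ξ) ⟨ξ i, h⟩
      else τ.move ((List.range i).map ξ) ⟨ξ i, h⟩ := fun i => by
    rw [← hhist]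
    rfl
  have h0 : ∀ i (hi : ξ i ∈ G.V₀), σ.move ((List.range i).map ξ) ⟨ξ i, hi⟩ = ξ (i + 1) :=
    fun i hi => by rw [hstep, dif_pos hi]
  have h1 : ∀ i (hi : ξ i ∈ G.V₁), τ.move ((List.range i).map ξ) ⟨ξ i, hi⟩ = ξ (i + 1) :=
    fun i hi => by rw [hstep, dif_neg hi]
  have hplay : G.IsPlay ξ := fun i => by
    by_cases hi : ξ i ∈ G.V₀
    · rw [← h0 i hi]; exact σ.legal _ ⟨ξ i, hi⟩
    · rw [← h1 i hi]; exact τ.legal _ ⟨ξ i, hi⟩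
  exact ⟨ξ, ⟨hplay, h0⟩, ⟨hplay, h1⟩, rfl⟩

/-- Two winning strategies played against each other would produce one play won by both players. -/
theorem disjoint_Win (G : CofairGraph V) (Φ : Set (ℕ → V)) : Disjoint (G.Win₀ Φ) (G.Win₁ Φ) := by
  refine Set.disjoint_left.2 fun v ⟨σ, hσ⟩ ⟨τ, hτ⟩ => ?_
  obtain ⟨ξ, h0, h1, e⟩ := exists_joint_play σ τ v
  exact hτ ξ h1 e (hσ ξ h0 e)

end CofairGraph

theorem mainTheorem1 {V : Type*} [Fintype V] (G : CofairGraph V) (B : Set V) (L : ℕ)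
    (hL : L = B.ncard + G.Vf.ncard) :
    -- the inequalities say that no lifting exceeds the ranking
    (∀ ρ : V → Rank L, G.IsCofairCoBuchiPM B ρ ↔ ∀ v, G.lift B ρ v ≤ ρ) ∧
    -- lifting is monotone
    (∀ v : V, Monotone fun ρ : V → Rank L => G.lift B ρ v) ∧
    -- lifting never decreases a ranking obtained by liftings from the smallest one
    (∀ (s : ℕ → V) (n : ℕ) (v : V),
      (G.liftRun B s n : V → Rank L) ≤ G.lift B (G.liftRun B s n) v) ∧
    ∃ ρs : V → Rank L,
      -- `ρs` is the least fixpoint and the least ranking that satisfies the inequalities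
      IsLeast {ρ : V → Rank L | ∀ v, G.lift B ρ v = ρ} ρs ∧
      IsLeast {ρ : V → Rank L | G.IsCofairCoBuchiPM B ρ} ρs ∧
      -- lifting in any order that never neglects a vertex reaches `ρs` after finitely many steps
      (∀ s : ℕ → V, (∀ v, ∃ᶠ n in Filter.atTop, s n = v) →
        ∀ᶠ n in Filter.atTop, G.liftRun B s n = ρs) ∧
      -- lifting until nothing changes any more ends in `ρs`
      (∀ (s : ℕ → V) (n : ℕ),
        (∀ v, G.lift B (G.liftRun B s n : V → Rank L) v = G.liftRun B s n) →
        G.liftRun B s n = ρs) ∧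
      -- `ρs` distinguishes the winning regions
      G.Win₀ (CofairGraph.coBuchi B) = {v | ρs v ≠ ⊤} ∧
      G.Win₁ (CofairGraph.coBuchi B) = {v | ρs v = ⊤} := by
  obtain ⟨ρs, h⟩ := CofairGraph.exists_isLeast_isPM L G B
  refine ⟨fun ρ => CofairGraph.isPM_iff_lift_le, CofairGraph.lift_mono,
    CofairGraph.liftRun_le_lift, ρs, CofairGraph.isLeast_lift_eq_of_isLeast h, h,
    CofairGraph.eventually_liftRun_eq h, CofairGraph.liftRun_eq_of_isLeast h, ?_, ?_⟩
  · refine Set.Subset.antisymm (fun v hv ht => ?_) fun v hv =>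
      CofairGraph.mem_Win₀_of_ne_top h.1 hv
    exact Set.disjoint_left.1 (G.disjoint_Win _) hv (CofairGraph.mem_Win₁_of_eq_top hL h ht)
  · refine Set.Subset.antisymm (fun v hv => ?_) fun v hv =>
      CofairGraph.mem_Win₁_of_eq_top hL h hv
    by_contra ht
    exact Set.disjoint_left.1 (G.disjoint_Win _) (CofairGraph.mem_Win₀_of_ne_top h.1 ht) hv
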